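/- **Theorem (Bianchi identities).** Let $M$ be a finite-dimensional Hausdorff smooth manifold without boundary and let $E\to M$ be a smooth real vector bundle of finite rank with a smooth linear connection $\gamma$, given by its covariant derivative $\nabla$ (additive in the section, pointwise linear in the direction, with $\nabla_{\mathcal X}(f\sigma)=\mathcal X(f)\,\sigma+f\,\nabla_{\mathcal X}\sigma$). Let $R$ be the curvature $2$-form of $\gamma$, that is, the $\mathrm{End}(E)$-valued $2$-form with $$R(\mathcal X,\mathcal Y)\sigma=\nabla_{\mathcal X}\nabla_{\mathcal Y}\sigma-\nabla_{\mathcal Y}\nabla_{\mathcal X}\sigma-\nabla_{[\mathcal X,\mathcal Y]}\sigma .$$ Equip $\mathrm{End}(E)$ with the induced connection $(\nabla_{\mathcal X}T)\sigma=\nabla_{\mathcal X}(T\sigma)-T(\nabla_{\mathcal X}\sigma)$. For a form $\alpha$ of degree $p\ge 1$ with values in a vector bundle with a linear connection, the covariant exterior derivative $d_\gamma\alpha$ is given on vector fields $\mathcal X_1,\dots,\mathcal X_{p+1}$ by $$d_\gamma\alpha(\mathcal X_1,\dots,\mathcal X_{p+1})=\sum_{i}(-1)^{i+1}\nabla_{\mathcal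 X_i}\bigl(\alpha(\mathcal X_1,\dots,\widehat{\mathcal X_i},\dots,\mathcal X_{p+1})\bigr)+\sum_{i<j}(-1)^{i+j}\alpha([\mathcal X_i,\mathcal X_j],\mathcal X_1,\dots,\widehat{\mathcal X_i},\dots,\widehat{\mathcal X_j},\dots,\mathcal X_{p+1}).$$ Then $$d_\gamma R=0,$$ i.e. $d_\gamma R(\mathcal X_1,\mathcal X_2,\mathcal X_3)=0$ on $U$ for every open set $U\subseteq M$ and all smooth vector fields $\mathcal X_1,\mathcal X_2,\mathcal X_3$ on $U$. -/

import Mathlib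

open Bundle FiberBundle
open scoped Manifold ContDiff Topology

namespace BianchiIdentities

set_option linter.unusedSectionVars false

section

variable {E : Type*} [NormedAddCommGroup E] [NormedSpace ℝ E]
  {H : Type*} [TopologicalSpace H] {I : ModelWithCorners ℝ E H}
  {M : Type*} [TopologicalSpace M] [ChartedSpace H M]
  {F : Type*} [NormedAddCommGroup F] [NormedSpace ℝ F]
  {V : M → Type*} [TopologicalSpace (TotalSpace F V)]
  [∀ x, AddCommGroup (V x)] [∀ x, Module ℝ (V x)] [∀ x, TopologicalSpace (V x)]
  [∀ x, IsTopologicalAddGroup (V x)] [∀ x, ContinuousSMul ℝ (V x)]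
  [FiberBundle F V]

/-- The covariant derivative `∇_X σ` of a section `σ` along a vector field `X`. -/
noncomputable def nabla (cov : CovariantDerivative I F V) (X : Π x : M, TangentSpace I x) (σ : Π x : M, V x) :
    Π x : M, V x :=
  fun x => cov σ x (X x)

/-- The operator `∇_X ∇_Y - ∇_Y ∇_X - ∇_{[X, Y]}` on sections. -/
noncomputable def nablaCommutator (cov : CovariantDerivative I F V)
    (X Y : Π x : M, TangentSpace I x) (σ : Π x : M, V x) : Π x : M, V x :=
  nabla cov X (nabla cov Y σ) - nabla cov Y (nabla cov X σ) -
    nabla cov (VectorField.mlieBracket I X Y) σ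

/-- The covariant exterior derivative `d_γ α` of a `W`-valued form `α` of degree `p = n + 1`,
evaluated on `p + 1` vector fields:
`∑ᵢ (-1)ⁱ ∇_{Xᵢ} (α (X₀, …, X̂ᵢ, …, X_p))
  + ∑_{i < k} (-1)^{i + k} α ([Xᵢ, X_k], X₀, …, X̂ᵢ, …, X̂_k, …, X_p)`.
The indices start at `0`, and a pair `i < k` is written as `k = j + 1` with `i ≤ j`. -/
noncomputable def covExtDeriv {n : ℕ} (cov : CovariantDerivative I F V)
    (α : Π x : M, TangentSpace I x [⋀^Fin (n + 1)]→ₗ[ℝ] V x)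
    (X : Fin (n + 2) → Π x : M, TangentSpace I x) : Π x : M, V x :=
  fun x =>
    (∑ i : Fin (n + 2), (-1 : ℝ) ^ (i : ℕ) •
      nabla cov (X i) (fun y => α y (i.removeNth fun k => X k y)) x) +
    ∑ i : Fin (n + 1), ∑ j ≥ i, (-1 : ℝ) ^ (i + (j + 1) : ℕ) •
      α x (Matrix.vecCons (VectorField.mlieBracket I (X i.castSucc) (X j.succ) x)
        (j.removeNth (i.castSucc.removeNth fun k => X k x)))

variable [VectorBundle ℝ F V]

variable (F) in
/-- The local extension of a vector `u` of the fibre over `x` to a section of `V`: constant in the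
preferred trivialization at `x`, hence smooth near `x` (and `0` where this is not defined). -/
noncomputable def localExt {x : M} (u : V x) : Π y : M, V y :=
  fun y => (trivializationAt F V x).symmL ℝ y ((trivializationAt F V x).continuousLinearMapAt ℝ x u)

theorem localExt_self {x : M} (u : V x) : localExt F u x = u := by
  exact (trivializationAt F V x).symmL_continuousLinearMapAt (R := ℝ)
    (mem_baseSet_trivializationAt' x) u

theorem localExt_add {x : M} (u v : V x) : localExt F (u + v) = localExt F u + localExt F v := by
  ext y; simp [localExt]

theorem localExt_smul {x : M} (c : ℝ) (u : V x) : localExt F (c • u) = c • localExt F u := by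
  ext y; simp [localExt]

section EndBundle

variable [FiniteDimensional ℝ F] [ContMDiffVectorBundle 1 F V I]

/-- A section `T` of `End V = Hom(V, V)` is differentiable at `x`. -/
def EndDiffAt (T : Π x : M, V x →L[ℝ] V x) (x : M) : Prop :=
  MDifferentiableAt I (I.prod 𝓘(ℝ, F →L[ℝ] F))
    (fun y => TotalSpace.mk' (F →L[ℝ] F) (E := fun x => V x →L[ℝ] V x) y (T y)) x

theorem endTensorial (cov : CovariantDerivative I F V) {x : M} {T : Π x : M, V x →L[ℝ] V x}
    (hT : EndDiffAt (I := I) (F := F) T x) :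
    TensorialAt I F (fun σ : Π x : M, V x =>
      cov (fun y => T y (σ y)) x - (T x).comp (cov σ x)) x := by
  have hc := cov.isCovariantDerivativeOnUniv
  constructor
  · intro f σ hf hσ
    have h1 : MDiffAt (T% (fun y => T y (σ y))) x := hT.clm_bundle_apply hσ
    have e : (fun y => T y ((f • σ) y)) = f • (fun y => T y (σ y)) := by
      ext y; simp
    ext ξ
    rw [e, hc.leibniz h1 hf, hc.leibniz hσ hf]
    simp [smul_sub]
  · intro σ τ hσ hτ
    have h1 : MDiffAt (T% (fun y => T y (σ y))) x := hT.clm_bundle_apply hσ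
    have h2 : MDiffAt (T% (fun y => T y (τ y))) x := hT.clm_bundle_apply hτ
    have e : (fun y => T y ((σ + τ) y)) = (fun y => T y (σ y)) + (fun y => T y (τ y)) := by
      ext y; simp
    ext ξ
    rw [e, hc.add h1 h2, hc.add hσ hτ]
    simp
    abel

/-- Exchanging the two arguments of a bilinear map on finite-dimensional spaces. -/
noncomputable def flipBilin [FiniteDimensional ℝ E] {x : M}
    (B : V x →L[ℝ] TangentSpace I x →L[ℝ] V x) : TangentSpace I x →L[ℝ] V x →L[ℝ] V x :=
  haveI : FiniteDimensional ℝ (TangentSpace I x) := inferInstanceAs (FiniteDimensional ℝ E)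
  haveI : T2Space (TangentSpace I x) := inferInstanceAs (T2Space E)
  LinearMap.toContinuousLinearMap
    { toFun := fun ξ =>
        { toFun := fun u => B u ξ
          map_add' := by intro u v; simp
          map_smul' := by intro c u; simp
          cont := (ContinuousEvalConst.continuous_eval_const ξ).comp B.continuous }
      map_add' := by intro ξ η; ext u; simp
      map_smul' := by intro c ξ; ext u; simp }

open Classical in
/-- The covariant derivative of a section `T` of `End V`: if `T` is differentiable at `x`, then
`(∇_ξ T) u = ∇_ξ (T σ) - T (∇_ξ σ)` at `x`, for any section `σ` that is differentiable at `x` with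
`σ x = u`. -/
noncomputable def endNabla [FiniteDimensional ℝ E] (cov : CovariantDerivative I F V)
    (T : Π x : M, V x →L[ℝ] V x) (x : M) : TangentSpace I x →L[ℝ] V x →L[ℝ] V x :=
  if hT : EndDiffAt (I := I) (F := F) T x then
    flipBilin (TensorialAt.mkHom _ x (endTensorial cov hT))
  else 0

theorem endNabla_apply [FiniteDimensional ℝ E] (cov : CovariantDerivative I F V)
    {T : Π x : M, V x →L[ℝ] V x} {x : M} (hT : EndDiffAt (I := I) (F := F) T x)
    (ξ : TangentSpace I x) {σ : Π x : M, V x} (hσ : MDiffAt (T% σ) x) :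
    endNabla cov T x ξ (σ x) = cov (fun y => T y (σ y)) x ξ - T x (cov σ x ξ) := by
  have h := TensorialAt.mkHom_apply (endTensorial cov hT) hσ
  rw [endNabla, dif_pos hT]
  exact congrArg (fun B : TangentSpace I x →L[ℝ] V x => B ξ) h

/-- The linear connection on `End V` induced by a linear connection on `V`. -/
noncomputable def endConnection [FiniteDimensional ℝ E] (cov : CovariantDerivative I F V) :
    CovariantDerivative I (F →L[ℝ] F) (fun x : M => V x →L[ℝ] V x) where
  toFun := endNabla cov
  isCovariantDerivativeOnUniv := by
    have hc := cov.isCovariantDerivativeOnUniv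
    constructor
    · intro S T x hS hT _
      have hST : EndDiffAt (I := I) (F := F) (S + T) x := mdifferentiableAt_add_section hS hT
      ext ξ u
      have h := mdifferentiableAt_extend I F u
      have h1 : MDiffAt (T% (fun y => S y (extend F u y))) x := hS.clm_bundle_apply h
      have h2 : MDiffAt (T% (fun y => T y (extend F u y))) x := hT.clm_bundle_apply h
      have e : (fun y => (S + T) y (extend F u y)) =
        (fun y => S y (extend F u y)) + (fun y => T y (extend F u y)) := rfl
      have k0 := endNabla_apply cov hST ξ h
      have k1 := endNabla_apply cov hS ξ h
      have k2 := endNabla_apply cov hT ξ h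
      rw [extend_apply_self] at k0 k1 k2
      simp only [add_apply]
      rw [k0, k1, k2, e, hc.add h1 h2]
      simp
      abel
    · intro T g x hT hg _
      have hgT : EndDiffAt (I := I) (F := F) (g • T) x := hg.smul_section hT
      ext ξ u
      have h := mdifferentiableAt_extend I F u
      have h1 : MDiffAt (T% (fun y => T y (extend F u y))) x := hT.clm_bundle_apply h
      have e : (fun y => (g • T) y (extend F u y)) = g • (fun y => T y (extend F u y)) := rfl
      have k0 := endNabla_apply cov hgT ξ h
      have k1 := endNabla_apply cov hT ξ h
      rw [extend_apply_self] at k0 k1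
      simp only [add_apply, smul_apply]
      rw [k0, k1, e, hc.leibniz h1 hg]
      simp [smul_sub]
      abel

end EndBundle

section Curvature

variable [FiniteDimensional ℝ E] [FiniteDimensional ℝ F] [IsManifold I ∞ M] [T2Space M]
  [ContMDiffVectorBundle ∞ F V I]

/-- Smooth connections preserve smoothness on open sets. -/
theorem contMDiffAt_cov (cov : CovariantDerivative I F V) [cov.ContMDiffCovariantDerivative ∞]
    {U : Set M} (hU : IsOpen U) {σ : Π x : M, V x} (hσ : CMDiff[U] ∞ (T% σ)) {x : M} (hx : x ∈ U) :
    ContMDiffAt I (I.prod 𝓘(ℝ, E →L[ℝ] F)) ∞ (fun y =>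
      TotalSpace.mk' (E →L[ℝ] F) (E := fun z : M => TangentSpace I z →L[ℝ] V z) y (cov σ y)) x := by
  obtain ⟨f, -, hfU⟩ := (SmoothBumpFunction.nhds_basis_tsupport (I := I) x).mem_iff.1
    (hU.mem_nhds hx)
  have h1 : CMDiff ∞ (T% ((f : M → ℝ) • σ)) :=
    ContMDiffOn.smul_section_of_tsupport f.contMDiff.contMDiffOn hU hfU hσ
  have h2 := (CovariantDerivative.ContMDiffCovariantDerivative.contMDiff (cov := cov)
    (k := ∞)).contMDiff (σ := (f : M → ℝ) • σ) (by simpa using h1.contMDiffOn)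
  refine (h2.contMDiffAt (x := x) Filter.univ_mem).congr_of_eventuallyEq ?_
  filter_upwards [f.eventuallyEq_one.eventually_nhds, hU.mem_nhds hx] with y hy hyU
  have : cov σ y = cov ((f : M → ℝ) • σ) y := by
    refine cov.isCovariantDerivativeOnUniv.congr_of_eventuallyEq
      ((hσ.contMDiffAt (hU.mem_nhds hyU)).mdifferentiableAt (by simp))
      ((h1 y).mdifferentiableAt (by simp)) Filter.univ_mem ?_
    filter_upwards [hy] with z hz
    simp [hz]
  rw [this]

theorem contMDiffOn_nabla (cov : CovariantDerivative I F V) [cov.ContMDiffCovariantDerivative ∞]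
    {U : Set M} (hU : IsOpen U) {σ : Π x : M, V x} (hσ : CMDiff[U] ∞ (T% σ))
    {X : Π x : M, TangentSpace I x} (hX : CMDiff[U] ∞ (T% X)) :
    CMDiff[U] ∞ (T% (nabla cov X σ)) := fun x hx =>
  ((contMDiffAt_cov cov hU hσ hx).clm_bundle_apply
    (hX.contMDiffAt (hU.mem_nhds hx))).contMDiffWithinAt

theorem nabla_add (cov : CovariantDerivative I F V) {x : M} {σ τ : Π x : M, V x}
    (hσ : MDiffAt (T% σ) x) (hτ : MDiffAt (T% τ) x) (X : Π x : M, TangentSpace I x) :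
    nabla cov X (σ + τ) x = nabla cov X σ x + nabla cov X τ x := by
  simp [nabla, cov.isCovariantDerivativeOnUniv.add hσ hτ]

theorem nabla_smul (cov : CovariantDerivative I F V) {x : M} {σ : Π x : M, V x}
    (hσ : MDiffAt (T% σ) x) (c : ℝ) (X : Π x : M, TangentSpace I x) :
    nabla cov X (c • σ) x = c • nabla cov X σ x := by
  simp [nabla, cov.isCovariantDerivativeOnUniv.smul_const c hσ]

theorem nabla_congr (cov : CovariantDerivative I F V) {x : M} {σ τ : Π x : M, V x}
    (hτ : MDiffAt (T% τ) x) (h : ∀ᶠ y in 𝓝 x, σ y = τ y) (X : Π x : M, TangentSpace I x) :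
    nabla cov X σ x = nabla cov X τ x := by
  have hσ : MDiffAt (T% σ) x := hτ.congr_of_eventuallyEq (h.mono fun y hy => by simp [hy])
  simp [nabla, cov.isCovariantDerivativeOnUniv.congr_of_eventuallyEq hσ hτ Filter.univ_mem h]

theorem mdiffAt_of_contMDiffOn {U : Set M} (hU : IsOpen U) {σ : Π x : M, V x}
    (hσ : CMDiff[U] ∞ (T% σ)) {x : M} (hx : x ∈ U) : MDiffAt (T% σ) x :=
  (hσ.contMDiffAt (hU.mem_nhds hx)).mdifferentiableAt (by simp)

section Commutator

variable (cov : CovariantDerivative I F V) [cov.ContMDiffCovariantDerivative ∞]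
  {U : Set M} {x : M}

theorem nablaCommutator_add (hU : IsOpen U) (hx : x ∈ U)
    {X Y : Π x : M, TangentSpace I x} {σ τ : Π x : M, V x}
    (hX : CMDiff[U] ∞ (T% X)) (hY : CMDiff[U] ∞ (T% Y))
    (hσ : CMDiff[U] ∞ (T% σ)) (hτ : CMDiff[U] ∞ (T% τ)) :
    nablaCommutator cov X Y (σ + τ) x =
      nablaCommutator cov X Y σ x + nablaCommutator cov X Y τ x := by
  have key : ∀ {X Y : Π x : M, TangentSpace I x}, CMDiff[U] ∞ (T% Y) →
      nabla cov X (nabla cov Y (σ + τ)) x =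
        nabla cov X (nabla cov Y σ) x + nabla cov X (nabla cov Y τ) x := by
    intro X Y hY
    have h1 := mdiffAt_of_contMDiffOn hU (contMDiffOn_nabla cov hU hσ hY) hx
    have h2 := mdiffAt_of_contMDiffOn hU (contMDiffOn_nabla cov hU hτ hY) hx
    rw [← nabla_add cov h1 h2]
    refine nabla_congr cov (mdifferentiableAt_add_section h1 h2) ?_ X
    filter_upwards [hU.mem_nhds hx] with y hy
    exact nabla_add cov (mdiffAt_of_contMDiffOn hU hσ hy) (mdiffAt_of_contMDiffOn hU hτ hy) Y
  simp only [nablaCommutator, Pi.sub_apply]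
  rw [key hY, key hX,
    nabla_add cov (mdiffAt_of_contMDiffOn hU hσ hx) (mdiffAt_of_contMDiffOn hU hτ hx)]
  abel

theorem nablaCommutator_smul (hU : IsOpen U) (hx : x ∈ U)
    {X Y : Π x : M, TangentSpace I x} {σ : Π x : M, V x} (c : ℝ)
    (hX : CMDiff[U] ∞ (T% X)) (hY : CMDiff[U] ∞ (T% Y)) (hσ : CMDiff[U] ∞ (T% σ)) :
    nablaCommutator cov X Y (c • σ) x = c • nablaCommutator cov X Y σ x := by
  have key : ∀ {X Y : Π x : M, TangentSpace I x}, CMDiff[U] ∞ (T% Y) →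
      nabla cov X (nabla cov Y (c • σ)) x = c • nabla cov X (nabla cov Y σ) x := by
    intro X Y hY
    have h1 := mdiffAt_of_contMDiffOn hU (contMDiffOn_nabla cov hU hσ hY) hx
    rw [← nabla_smul cov h1]
    refine nabla_congr cov
      (mdifferentiableAt_const (c := c) |>.smul_section h1) ?_ X
    filter_upwards [hU.mem_nhds hx] with y hy
    exact nabla_smul cov (mdiffAt_of_contMDiffOn hU hσ hy) c Y
  simp only [nablaCommutator, Pi.sub_apply]
  rw [key hY, key hX, nabla_smul cov (mdiffAt_of_contMDiffOn hU hσ hx)]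
  simp [smul_sub]

theorem nablaCommutator_swap (X Y : Π x : M, TangentSpace I x) (σ : Π x : M, V x) :
    nablaCommutator cov Y X σ x = - nablaCommutator cov X Y σ x := by
  simp only [nablaCommutator, Pi.sub_apply]
  rw [VectorField.mlieBracket_swap (V := Y) (W := X)]
  simp [nabla]
  abel

theorem nablaCommutator_add_left (hU : IsOpen U) (hx : x ∈ U)
    {X X' Y : Π x : M, TangentSpace I x} {σ : Π x : M, V x}
    (hX : CMDiff[U] ∞ (T% X)) (hX' : CMDiff[U] ∞ (T% X')) (hσ : CMDiff[U] ∞ (T% σ)) :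
    nablaCommutator cov (X + X') Y σ x =
      nablaCommutator cov X Y σ x + nablaCommutator cov X' Y σ x := by
  have : CompleteSpace E := FiniteDimensional.complete ℝ E
  have h1 := mdiffAt_of_contMDiffOn hU (contMDiffOn_nabla cov hU hσ hX) hx
  have h2 := mdiffAt_of_contMDiffOn hU (contMDiffOn_nabla cov hU hσ hX') hx
  have e : nabla cov (X + X') σ = nabla cov X σ + nabla cov X' σ := by
    ext y; simp [nabla]
  simp only [nablaCommutator, Pi.sub_apply]
  rw [e, nabla_add cov h1 h2]
  simp only [nabla, Pi.add_apply]
  rw [VectorField.mlieBracket_add_left (mdiffAt_of_contMDiffOn hU hX hx)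
    (mdiffAt_of_contMDiffOn hU hX' hx)]
  simp
  abel

theorem nablaCommutator_smul_left (hU : IsOpen U) (hx : x ∈ U)
    {X Y : Π x : M, TangentSpace I x} {σ : Π x : M, V x} (c : ℝ)
    (hX : CMDiff[U] ∞ (T% X)) (hσ : CMDiff[U] ∞ (T% σ)) :
    nablaCommutator cov (c • X) Y σ x = c • nablaCommutator cov X Y σ x := by
  have : CompleteSpace E := FiniteDimensional.complete ℝ E
  have h1 := mdiffAt_of_contMDiffOn hU (contMDiffOn_nabla cov hU hσ hX) hx
  have e : nabla cov (c • X) σ = c • nabla cov X σ := by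
    ext y; simp [nabla]
  simp only [nablaCommutator, Pi.sub_apply]
  rw [e, nabla_smul cov h1]
  simp only [nabla, Pi.smul_apply]
  rw [VectorField.mlieBracket_const_smul_left (mdiffAt_of_contMDiffOn hU hX hx)]
  simp [smul_sub]

end Commutator

theorem exists_open_localExt (x : M) : ∃ U : Set M, IsOpen U ∧ x ∈ U ∧
    ∀ u : V x, CMDiff[U] ∞ (T% (localExt F u)) := by
  refine ⟨_, (trivializationAt F V x).open_baseSet, mem_baseSet_trivializationAt' x, fun u => ?_⟩
  intro y hy
  rw [(trivializationAt F V x).contMDiffWithinAt_section _ hy]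
  have : CMDiff[(trivializationAt F V x).baseSet] ∞
      (fun _ : M => (trivializationAt F V x).continuousLinearMapAt ℝ x u) := contMDiffOn_const
  exact this.congr (fun z hz => by
    rw [localExt, Bundle.Trivialization.symmL_apply _ hz, Bundle.Trivialization.apply_mk_symm _ hz])
    y hy

/-- An open neighbourhood of `x` on which the standard extensions are smooth. -/
theorem exists_open_localExt₂ (x : M) : ∃ U : Set M, IsOpen U ∧ x ∈ U ∧
    (∀ ξ : TangentSpace I x,
      CMDiff[U] ∞ (T% (localExt E (V := (TangentSpace I : M → Type _)) ξ))) ∧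
    (∀ u : V x, CMDiff[U] ∞ (T% (localExt F u))) := by
  obtain ⟨U, hU, hxU, h⟩ := exists_open_localExt (I := I) (F := F) (V := V) x
  obtain ⟨U', hU', hxU', h'⟩ :=
    exists_open_localExt (I := I) (F := E) (V := (TangentSpace I : M → Type _)) x
  exact ⟨U' ∩ U, hU'.inter hU, ⟨hxU', hxU⟩, fun ξ => (h' ξ).mono Set.inter_subset_left,
    fun u => (h u).mono Set.inter_subset_right⟩

/-- The endomorphism `R(ξ, η)` of the fibre `V x`. -/
noncomputable def curvatureAux (cov : CovariantDerivative I F V)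
    [cov.ContMDiffCovariantDerivative ∞] (x : M) (ξ η : TangentSpace I x) : V x →ₗ[ℝ] V x where
  toFun u := nablaCommutator cov (localExt E ξ) (localExt E η) (localExt F u) x
  map_add' u v := by
    obtain ⟨U, hU, hx, h1, h2⟩ := exists_open_localExt₂ (I := I) (F := F) (V := V) x
    rw [localExt_add, nablaCommutator_add cov hU hx (h1 ξ) (h1 η) (h2 u) (h2 v)]
  map_smul' c u := by
    obtain ⟨U, hU, hx, h1, h2⟩ := exists_open_localExt₂ (I := I) (F := F) (V := V) x
    rw [localExt_smul, nablaCommutator_smul cov hU hx c (h1 ξ) (h1 η) (h2 u)]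
    rfl

theorem curvatureAux_swap (cov : CovariantDerivative I F V)
    [cov.ContMDiffCovariantDerivative ∞] (x : M) (ξ η : TangentSpace I x) :
    curvatureAux cov x η ξ = - curvatureAux cov x ξ η := by
  ext u
  exact nablaCommutator_swap cov _ _ _

theorem curvatureAux_add (cov : CovariantDerivative I F V)
    [cov.ContMDiffCovariantDerivative ∞] (x : M) (ξ ξ' η : TangentSpace I x) :
    curvatureAux cov x (ξ + ξ') η = curvatureAux cov x ξ η + curvatureAux cov x ξ' η := by
  obtain ⟨U, hU, hx, h1, h2⟩ := exists_open_localExt₂ (I := I) (F := F) (V := V) x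
  ext u
  simp only [curvatureAux, LinearMap.coe_mk, AddHom.coe_mk, LinearMap.add_apply]
  rw [localExt_add (V := (TangentSpace I : M → Type _)),
    nablaCommutator_add_left cov hU hx (h1 ξ) (h1 ξ') (h2 u)]

theorem curvatureAux_smul (cov : CovariantDerivative I F V)
    [cov.ContMDiffCovariantDerivative ∞] (x : M) (c : ℝ) (ξ η : TangentSpace I x) :
    curvatureAux cov x (c • ξ) η = c • curvatureAux cov x ξ η := by
  obtain ⟨U, hU, hx, h1, h2⟩ := exists_open_localExt₂ (I := I) (F := F) (V := V) x
  ext u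
  simp only [curvatureAux, LinearMap.coe_mk, AddHom.coe_mk, LinearMap.smul_apply]
  rw [localExt_smul (V := (TangentSpace I : M → Type _)),
    nablaCommutator_smul_left cov hU hx c (h1 ξ) (h2 u)]

/-- The curvature `2`-form of a connection, with values in `End V`: the endomorphism `R_x(ξ, η)` is
`u ↦ (∇_X ∇_Y σ - ∇_Y ∇_X σ - ∇_{[X, Y]} σ)(x)`, for the smooth local extensions
`X`, `Y`, `σ` of `ξ`, `η`, `u` that are constant in the preferred trivializations at `x`. -/
noncomputable def curvature (cov : CovariantDerivative I F V)
    [cov.ContMDiffCovariantDerivative ∞] (x : M) :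
    TangentSpace I x [⋀^Fin 2]→ₗ[ℝ] (V x →L[ℝ] V x) :=
  haveI : T2Space (V x) := FiberBundle.t2Space F V x
  haveI : FiniteDimensional ℝ (V x) := VectorBundle.finiteDimensional ℝ F V x
  { toFun := fun v => LinearMap.toContinuousLinearMap (curvatureAux cov x (v 0) (v 1))
    map_update_add' := by
      intro _ v i ξ η
      rw [← map_add]
      congr 1
      fin_cases i
      · simpa using curvatureAux_add cov x ξ η (v 1)
      · simp only [Fin.mk_one, Function.update_self, ne_eq, zero_ne_one, not_false_eq_true,
          Function.update_of_ne]
        rw [← neg_inj, neg_add, ← curvatureAux_swap, ← curvatureAux_swap, ← curvatureAux_swap,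
          curvatureAux_add]
    map_update_smul' := by
      intro _ v i c ξ
      rw [← map_smul]
      congr 1
      fin_cases i
      · simpa using curvatureAux_smul cov x c ξ (v 1)
      · simp only [Fin.mk_one, Function.update_self, ne_eq, zero_ne_one, not_false_eq_true,
          Function.update_of_ne]
        rw [← neg_inj, ← smul_neg, ← curvatureAux_swap, ← curvatureAux_swap, curvatureAux_smul]
    map_eq_zero_of_eq' := by
      intro v i j hv hij
      have h : v 0 = v 1 := by
        fin_cases i <;> fin_cases j <;> simp_all
      have h2 : curvatureAux cov x (v 0) (v 1) = 0 := by
        have := curvatureAux_swap cov x (v 0) (v 0)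
        rw [← h]
        ext u
        have hu := LinearMap.congr_fun this u
        have h2u : (2 : ℝ) • curvatureAux cov x (v 0) (v 0) u = 0 := by
          rw [two_smul]
          exact add_eq_zero_iff_eq_neg.mpr hu
        exact (smul_eq_zero.mp h2u).resolve_left two_ne_zero
      rw [h2, map_zero] }

end Curvature

end

end BianchiIdentities

/-! As operators on sections, R(Y, Z) = [∇_Y, ∇_Z] - ∇_{[Y,Z]}, and the induced connection on End(V)
is the commutator: (∇_X T)σ = [∇_X, T]σ. Substituted into d_γ R, the triple commutators of the
∇_{X_i} cancel by the Jacobi identity for operators, the mixed terms ∇_{X_i} ∇_{[X_j,X_k]} cancel in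
pairs, and what is left is ∇ along the Jacobi sum of the vector fields, which is zero.

The work lies in justifying this calculus. `curvature` is defined pointwise through special
extensions, so `curvature_apply` must show that every choice of fields and section smooth near the
point gives the same value; this is tensoriality, from `SmoothTensorialAt.congr_value`.
`endDiffAt_curvature` then makes R(Y, Z) a differentiable section of End(V), so that
`nabla_endConnection_curvature` may use the commutator formula. -/

namespace BianchiIdentities

set_option linter.unusedSectionVars false

section

variable {E : Type*} [NormedAddCommGroup E] [NormedSpace ℝ E]
  {H : Type*} [TopologicalSpace H] {I : ModelWithCorners ℝ E H}
  {M : Type*} [TopologicalSpace M] [ChartedSpace H M]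
  {F : Type*} [NormedAddCommGroup F] [NormedSpace ℝ F]
  {V : M → Type*} [TopologicalSpace (TotalSpace F V)]
  [∀ x, AddCommGroup (V x)] [∀ x, Module ℝ (V x)] [∀ x, TopologicalSpace (V x)]
  [∀ x, IsTopologicalAddGroup (V x)] [∀ x, ContinuousSMul ℝ (V x)]
  [FiberBundle F V]

/-! ### Sections smooth near a point -/

variable (I F) in
/-- The section `σ` of `V` is smooth on a neighbourhood of `x`. -/
def SmoothNear (σ : Π x : M, V x) (x : M) : Prop :=
  ∀ᶠ y in 𝓝 x, CMDiffAt ∞ (T% σ) y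

variable (I) in
/-- The derivative of the function `f` along the vector field `X`. -/
noncomputable def dirDeriv (X : Π x : M, TangentSpace I x) (f : M → ℝ) (x : M) : ℝ :=
  d% f x (X x)

section SmoothNear

variable {σ τ : Π x : M, V x} {x : M}

theorem SmoothNear.of_contMDiffOn {U : Set M} (hU : IsOpen U) (hx : x ∈ U)
    (h : CMDiff[U] ∞ (T% σ)) : SmoothNear I F σ x := by
  filter_upwards [hU.mem_nhds hx] with y hy
  exact h.contMDiffAt (hU.mem_nhds hy)

theorem SmoothNear.eventually (h : SmoothNear I F σ x) : ∀ᶠ y in 𝓝 x, SmoothNear I F σ y :=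
  Filter.Eventually.eventually_nhds h

theorem SmoothNear.mdiffAt (h : SmoothNear I F σ x) : MDiffAt (T% σ) x :=
  h.self_of_nhds.mdifferentiableAt (by simp)

theorem SmoothNear.congr (h : SmoothNear I F τ x) (he : ∀ᶠ y in 𝓝 x, σ y = τ y) :
    SmoothNear I F σ x := by
  filter_upwards [h, he.eventually_nhds] with y hy hy'
  exact hy.congr_of_eventuallyEq (hy'.mono fun z hz => by simp [hz])

variable [VectorBundle ℝ F V]

theorem SmoothNear.add (hσ : SmoothNear I F σ x) (hτ : SmoothNear I F τ x) :
    SmoothNear I F (σ + τ) x := by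
  filter_upwards [hσ, hτ] with y h1 h2
  exact h1.add_section h2

theorem SmoothNear.sub (hσ : SmoothNear I F σ x) (hτ : SmoothNear I F τ x) :
    SmoothNear I F (σ - τ) x := by
  filter_upwards [hσ, hτ] with y h1 h2
  exact h1.sub_section h2

theorem SmoothNear.smul {f : M → ℝ} (hf : ∀ᶠ y in 𝓝 x, CMDiffAt ∞ f y)
    (hσ : SmoothNear I F σ x) : SmoothNear I F (f • σ) x := by
  filter_upwards [hf, hσ] with y h1 h2
  exact h1.smul_section h2

theorem SmoothNear.sum {ι : Type*} (s : Finset ι) {σ : ι → Π x : M, V x}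
    (h : ∀ i ∈ s, SmoothNear I F (σ i) x) :
    SmoothNear I F (fun y => ∑ i ∈ s, σ i y) x := by
  filter_upwards [(Filter.eventually_all_finset s).2 h] with y hy
  exact .sum_section hy

end SmoothNear

variable [VectorBundle ℝ F V]

/-! ### Tensorial operators depend only on the value at the point -/

section Pointwise

variable {A : Type*} [AddCommGroup A] [Module ℝ A]

variable (I F) in
/-- An operator on sections which is linear, at `x`, over the functions that are smooth near `x`,
when applied to sections that are smooth near `x`. -/
structure SmoothTensorialAt (Φ : (Π x : M, V x) → A) (x : M) : Prop where
  smul : ∀ {f : M → ℝ} {σ : Π x : M, V x}, (∀ᶠ y in 𝓝 x, CMDiffAt ∞ f y) →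
    SmoothNear I F σ x → Φ (f • σ) = f x • Φ σ
  add : ∀ {σ τ : Π x : M, V x}, SmoothNear I F σ x → SmoothNear I F τ x → Φ (σ + τ) = Φ σ + Φ τ

namespace SmoothTensorialAt

variable {Φ : (Π x : M, V x) → A} {x : M}

/-- No bump function is needed: the multiplier has to be smooth only near `x`, so the indicator of
the set where the two sections agree will do. -/
theorem congr_germ (hΦ : SmoothTensorialAt I F Φ x) {σ τ : Π x : M, V x}
    (hσ : SmoothNear I F σ x) (h : ∀ᶠ y in 𝓝 x, σ y = τ y) : Φ σ = Φ τ := by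
  classical
  have hτ : SmoothNear I F τ x := hσ.congr (h.mono fun _ hy => hy.symm)
  let ψ (y : M) : ℝ := if σ y = τ y then 1 else 0
  have hψx : ψ x = 1 := by simp [ψ, h.self_of_nhds]
  have e : ψ • σ = ψ • τ := by
    ext y
    dsimp [ψ]
    split_ifs with hy <;> simp [hy]
  have hψ : ∀ᶠ y in 𝓝 x, CMDiffAt ∞ ψ y := by
    filter_upwards [h.eventually_nhds] with y hy
    have : CMDiffAt ∞ (fun (_ : M) ↦ (1 : ℝ)) y := contMDiffAt_const
    exact this.congr_of_eventuallyEq (hy.mono fun z hz ↦ by simp [ψ, hz])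
  have h1 := hΦ.smul hψ hσ
  have h2 := hΦ.smul hψ hτ
  rw [hψx, one_smul] at h1 h2
  rw [← h1, ← h2, e]

theorem map_zero (hΦ : SmoothTensorialAt I F Φ x) : Φ 0 = 0 := by
  have h0 : SmoothNear I F (0 : Π x : M, V x) x :=
    Filter.Eventually.of_forall fun y => (contMDiff_zeroSection ℝ V) y
  have := hΦ.smul (f := 0) (Filter.Eventually.of_forall fun y => contMDiffAt_const) h0
  simpa using this

theorem map_sum (hΦ : SmoothTensorialAt I F Φ x) {ι : Type*} (s : Finset ι)
    (σ : ι → Π x : M, V x) (h : ∀ i ∈ s, SmoothNear I F (σ i) x) :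
    Φ (fun y => ∑ i ∈ s, σ i y) = ∑ i ∈ s, Φ (σ i) := by
  classical
  induction s using Finset.induction_on with
  | empty => simpa using! hΦ.map_zero
  | insert a s ha ih =>
    simp only [Finset.mem_insert, forall_eq_or_imp] at h
    simp only [Finset.sum_insert ha, ← ih h.2]
    exact hΦ.add h.1 (.sum s h.2)

variable [FiniteDimensional ℝ F] [ContMDiffVectorBundle ∞ F V I]

/-- Expanding in a local frame `s i` gives Φ σ = ∑ cᵢ(σ x) Φ(sᵢ), and the right side sees σ only
through `σ x`. The frame expansion holds only near `x`, hence the use of `congr_germ`. -/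
theorem congr_value (hΦ : SmoothTensorialAt I F Φ x) {σ τ : Π x : M, V x}
    (hσ : SmoothNear I F σ x) (hτ : SmoothNear I F τ x) (h : σ x = τ x) : Φ σ = Φ τ := by
  have : ContMDiffVectorBundle 1 F V I := .of_le (n := ∞) (by simp)
  let t := trivializationAt F V x
  have hx : x ∈ t.baseSet := FiberBundle.mem_baseSet_trivializationAt F V x
  let b := Module.Basis.ofVectorSpace ℝ F
  let s := t.localFrame b
  let c := t.localFrameCoeff I b
  have hs (i) : SmoothNear I F (s i) x :=
    .of_contMDiffOn t.open_baseSet hx (t.contMDiffOn_localFrame_baseSet ∞ b i)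
  have hc {σ : Π x : M, V x} (hσ : SmoothNear I F σ x) (i) :
      ∀ᶠ y in 𝓝 x, CMDiffAt ∞ (LinearMap.piApply (c i) σ) y := by
    filter_upwards [hσ, t.open_baseSet.mem_nhds hx] with y hy hyt
    exact contMDiffAt_localFrameCoeff b hyt hy i
  have key {σ : Π x : M, V x} (hσ : SmoothNear I F σ x) :
      Φ σ = ∑ i, c i x (σ x) • Φ (s i) := by
    rw [hΦ.congr_germ hσ (t.eventually_eq_localFrame_sum_coeff_smul (I := I) b hx)]
    refine (hΦ.map_sum Finset.univ (fun i => (LinearMap.piApply (c i) σ) • (s i))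
      fun i _ => .smul (hc hσ i) (hs i)).trans ?_
    exact Finset.sum_congr rfl fun i _ => hΦ.smul (hc hσ i) (hs i)
  rw [key hσ, key hτ, h]

end SmoothTensorialAt

end Pointwise

/-! ### Lie brackets and derivatives of functions -/

section DirDeriv

variable [FiniteDimensional ℝ E] [IsManifold I ∞ M] {X Y Z : Π x : M, TangentSpace I x} {x : M}

/-- X f is the fibre component of the tangent map of f composed with X, so it inherits smoothness
from both. -/
theorem eventually_contMDiffAt_dirDeriv {f : M → ℝ} (hf : ∀ᶠ y in 𝓝 x, CMDiffAt ∞ f y)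
    (hX : SmoothNear I E X x) : ∀ᶠ y in 𝓝 x, CMDiffAt ∞ (dirDeriv I X f) y := by
  obtain ⟨U, hU, hUo, hx⟩ := mem_nhds_iff.1 (hf.and hX)
  filter_upwards [hUo.mem_nhds hx] with y hy
  have h1 : CMDiff[U] ∞ f := fun z hz => (hU hz).1.contMDiffWithinAt
  have h2 : CMDiff[U] ∞ (T% X) := fun z hz => (hU hz).2.contMDiffWithinAt
  have h3 := (h1.contMDiffOn_tangentMapWithin (m := ∞) (by simp) hUo.uniqueMDiffOn).comp h2
    (fun z hz => hz)
  have h4 := (contMDiff_snd_tangentBundle_modelSpace (n := ∞) ℝ 𝓘(ℝ, ℝ)).comp_contMDiffOn h3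
  refine (h4.contMDiffAt (hUo.mem_nhds hy)).congr_of_eventuallyEq ?_
  filter_upwards [hUo.mem_nhds hy] with z hz
  change _ = mfderivWithin I 𝓘(ℝ, ℝ) f U z (X z)
  rw [mfderivWithin_of_isOpen hUo hz]
  rfl

theorem SmoothNear.mlieBracket (hX : SmoothNear I E X x) (hY : SmoothNear I E Y x) :
    SmoothNear I E (VectorField.mlieBracket I X Y) x := by
  have : CompleteSpace E := FiniteDimensional.complete ℝ E
  have : IsManifold I (minSmoothness ℝ 2) M :=
    .of_le (n := ∞) (by simpa using! ENat.LEInfty.out)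
  filter_upwards [hX, hY] with y h1 h2
  have : IsManifold I (((⊤ : ℕ∞) : ℕ∞ω) + 1) M := inferInstanceAs (IsManifold I ∞ M)
  exact ContMDiffAt.mlieBracket_vectorField (m := ⊤) (n := ⊤) h1 h2 (by simp)

theorem mlieBracket_jacobi (hX : SmoothNear I E X x) (hY : SmoothNear I E Y x)
    (hZ : SmoothNear I E Z x) :
    VectorField.mlieBracket I X (VectorField.mlieBracket I Y Z) x =
      VectorField.mlieBracket I (VectorField.mlieBracket I X Y) Z x +
      VectorField.mlieBracket I Y (VectorField.mlieBracket I X Z) x := by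
  have : CompleteSpace E := FiniteDimensional.complete ℝ E
  have : IsManifold I (minSmoothness ℝ 3) M := .of_le (n := ∞) (by simpa using! ENat.LEInfty.out)
  exact VectorField.leibniz_identity_mlieBracket_apply
    (hX.self_of_nhds.of_le (by simpa using! ENat.LEInfty.out))
    (hY.self_of_nhds.of_le (by simpa using! ENat.LEInfty.out))
    (hZ.self_of_nhds.of_le (by simpa using! ENat.LEInfty.out))

theorem eventually_mlieBracket_smul_right {f : M → ℝ} (hf : ∀ᶠ y in 𝓝 x, CMDiffAt ∞ f y)
    (hY : SmoothNear I E Y x) (X : Π x : M, TangentSpace I x) :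
    ∀ᶠ y in 𝓝 x, VectorField.mlieBracket I X (f • Y) y =
      (dirDeriv I X f • Y + f • VectorField.mlieBracket I X Y) y := by
  have : CompleteSpace E := FiniteDimensional.complete ℝ E
  have : IsManifold I 2 M := .of_le (n := ∞) ENat.LEInfty.out
  filter_upwards [hf, hY.eventually] with y h1 h2
  have h3 : MDiffAt f y := h1.mdifferentiableAt (by simp)
  exact VectorField.mlieBracket_smul_right h3 h2.mdiffAt

end DirDeriv

section DirDerivBracket

variable [FiniteDimensional ℝ E] [IsManifold I ∞ M] {X Y : Π x : M, TangentSpace I x} {x : M}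

theorem smoothNear_localExt [T2Space M] [FiniteDimensional ℝ F] [ContMDiffVectorBundle ∞ F V I]
    (u : V x) :
    SmoothNear I F (localExt F u) x := by
  obtain ⟨U, hU, hx, h⟩ := exists_open_localExt (I := I) (F := F) (V := V) x
  exact .of_contMDiffOn hU hx (h u)

theorem mdiffAt_of_eventually_contMDiffAt {f : M → ℝ} (hf : ∀ᶠ y in 𝓝 x, CMDiffAt ∞ f y) :
    MDiffAt f x :=
  hf.self_of_nhds.mdifferentiableAt (by simp)

/-- Compare the Jacobi identity for X, Y, fZ with f times the one for X, Y, Z. The Leibniz rule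
leaves ([X,Y]f - XYf + YXf) Z = 0 at `x`, and Z is chosen nonzero there. -/
theorem dirDeriv_mlieBracket [T2Space M] {f : M → ℝ} (hf : ∀ᶠ y in 𝓝 x, CMDiffAt ∞ f y)
    (hX : SmoothNear I E X x) (hY : SmoothNear I E Y x) :
    dirDeriv I (VectorField.mlieBracket I X Y) f x =
      dirDeriv I X (dirDeriv I Y f) x - dirDeriv I Y (dirDeriv I X f) x := by
  have : CompleteSpace E := FiniteDimensional.complete ℝ E
  have : IsManifold I 2 M := .of_le (n := ∞) ENat.LEInfty.out
  -- If `E` is trivial there is no nonzero Z, but then all directional derivatives vanish.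
  by_cases hE : ∃ v : E, v ≠ 0
  swap
  · have hz (Z : Π x : M, TangentSpace I x) (g : M → ℝ) : dirDeriv I Z g x = 0 := by
      have : Z x = 0 := not_not.1 fun h => hE ⟨Z x, h⟩
      simp [dirDeriv, this]
    simp [hz]
  obtain ⟨v, hv⟩ := hE
  let Z : Π y : M, TangentSpace I y :=
    localExt E (V := (TangentSpace I : M → Type _)) (x := x) v
  have hZx : Z x = v := localExt_self (V := (TangentSpace I : M → Type _)) (x := x) v
  have hZ : SmoothNear I E Z x := smoothNear_localExt (V := (TangentSpace I : M → Type _)) v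
  have hXf := eventually_contMDiffAt_dirDeriv hf hX
  have hYf := eventually_contMDiffAt_dirDeriv hf hY
  -- The two first-order terms together are symmetric in X and Y, so they drop out of the
  -- difference.
  have expand {X Y : Π x : M, TangentSpace I x} (hX : SmoothNear I E X x)
      (hY : SmoothNear I E Y x) :
      VectorField.mlieBracket I X (VectorField.mlieBracket I Y (f • Z)) x =
        dirDeriv I X (dirDeriv I Y f) x • Z x + dirDeriv I Y f x • VectorField.mlieBracket I X Z x +
        (dirDeriv I X f x • VectorField.mlieBracket I Y Z x +
          f x • VectorField.mlieBracket I X (VectorField.mlieBracket I Y Z) x) := by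
    have hYf := eventually_contMDiffAt_dirDeriv hf hY
    rw [Filter.EventuallyEq.mlieBracket_vectorField_eq (Filter.EventuallyEq.refl _ X)
      (eventually_mlieBracket_smul_right hf hZ Y),
      VectorField.mlieBracket_add_right (SmoothNear.smul hYf hZ).mdiffAt
        (SmoothNear.smul hf (hY.mlieBracket hZ)).mdiffAt,
      (eventually_mlieBracket_smul_right hYf hZ X).self_of_nhds,
      (eventually_mlieBracket_smul_right hf (hY.mlieBracket hZ) X).self_of_nhds]
    rfl
  have h1 := mlieBracket_jacobi hX hY (SmoothNear.smul hf hZ)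
  have h2 := mlieBracket_jacobi hX hY hZ
  rw [expand hX hY, expand hY hX,
    (eventually_mlieBracket_smul_right hf hZ (VectorField.mlieBracket I X Y)).self_of_nhds, h2] at h1
  have h3 : (dirDeriv I (VectorField.mlieBracket I X Y) f x -
      (dirDeriv I X (dirDeriv I Y f) x - dirDeriv I Y (dirDeriv I X f) x)) • Z x = 0 := by
    have h4 := sub_eq_zero.2 h1
    simp only [Pi.add_apply, Pi.smul_apply', smul_add] at h4
    rw [← neg_eq_zero, ← h4]
    module
  rw [hZx] at h3
  exact sub_eq_zero.1 ((smul_eq_zero.1 h3).resolve_right hv)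

end DirDerivBracket

/-! ### Tensoriality of the curvature operator -/

section Nabla

variable [FiniteDimensional ℝ E] [FiniteDimensional ℝ F] [IsManifold I ∞ M] [T2Space M]
  [ContMDiffVectorBundle ∞ F V I]
  (cov : CovariantDerivative I F V) [cov.ContMDiffCovariantDerivative ∞]
  {X Y Z : Π x : M, TangentSpace I x} {σ τ : Π x : M, V x} {x : M}

theorem SmoothNear.exists_open₃ (hX : SmoothNear I E X x) (hY : SmoothNear I E Y x)
    (hσ : SmoothNear I F σ x) : ∃ U : Set M, IsOpen U ∧ x ∈ U ∧
      CMDiff[U] ∞ (T% X) ∧ CMDiff[U] ∞ (T% Y) ∧ CMDiff[U] ∞ (T% σ) := by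
  obtain ⟨U, hU, hUo, hx⟩ := mem_nhds_iff.1 (hX.and (hY.and hσ))
  exact ⟨U, hUo, hx, fun y hy => (hU hy).1.contMDiffWithinAt,
    fun y hy => (hU hy).2.1.contMDiffWithinAt, fun y hy => (hU hy).2.2.contMDiffWithinAt⟩

theorem SmoothNear.nabla (hX : SmoothNear I E X x) (hσ : SmoothNear I F σ x) :
    SmoothNear I F (nabla cov X σ) x := by
  obtain ⟨U, hU, hx, h1, -, h2⟩ := hX.exists_open₃ hX hσ
  exact .of_contMDiffOn hU hx (contMDiffOn_nabla cov hU h2 h1)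

theorem SmoothNear.nablaCommutator (hX : SmoothNear I E X x) (hY : SmoothNear I E Y x)
    (hσ : SmoothNear I F σ x) : SmoothNear I F (nablaCommutator cov X Y σ) x :=
  ((hX.nabla cov (hY.nabla cov hσ)).sub
    (hY.nabla cov (hX.nabla cov hσ))).sub ((hX.mlieBracket hY).nabla cov hσ)

theorem nabla_sub (hσ : SmoothNear I F σ x) (hτ : SmoothNear I F τ x)
    (X : Π x : M, TangentSpace I x) :
    nabla cov X (σ - τ) x = nabla cov X σ x - nabla cov X τ x := by
  have h := nabla_add cov (hσ.sub hτ).mdiffAt hτ.mdiffAt X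
  rw [sub_add_cancel] at h
  rw [h, add_sub_cancel_right]

theorem eventually_nabla_smul {f : M → ℝ} (hf : ∀ᶠ y in 𝓝 x, CMDiffAt ∞ f y)
    (hσ : SmoothNear I F σ x) (X : Π x : M, TangentSpace I x) :
    ∀ᶠ y in 𝓝 x, nabla cov X (f • σ) y = (f • nabla cov X σ + dirDeriv I X f • σ) y := by
  filter_upwards [hf, hσ.eventually] with y h1 h2
  have h3 : MDiffAt f y := h1.mdifferentiableAt (by simp)
  simp [BianchiIdentities.nabla, dirDeriv,
    cov.isCovariantDerivativeOnUniv.leibniz h2.mdiffAt h3]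

theorem nabla_nabla_smul {f : M → ℝ} (hf : ∀ᶠ y in 𝓝 x, CMDiffAt ∞ f y)
    (hσ : SmoothNear I F σ x) (hY : SmoothNear I E Y x) (X : Π x : M, TangentSpace I x) :
    nabla cov X (nabla cov Y (f • σ)) x =
      f x • nabla cov X (nabla cov Y σ) x + dirDeriv I X f x • nabla cov Y σ x +
      (dirDeriv I Y f x • nabla cov X σ x + dirDeriv I X (dirDeriv I Y f) x • σ x) := by
  have hYf := eventually_contMDiffAt_dirDeriv hf hY
  have h1 := SmoothNear.smul hf (hY.nabla cov hσ)
  have h2 := SmoothNear.smul hYf hσ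
  rw [nabla_congr cov (h1.add h2).mdiffAt (eventually_nabla_smul cov hf hσ Y),
    nabla_add cov h1.mdiffAt h2.mdiffAt,
    (eventually_nabla_smul cov hf (hY.nabla cov hσ) X).self_of_nhds,
    (eventually_nabla_smul cov hYf hσ X).self_of_nhds]
  rfl

/-- First-order terms in f are symmetric in X, Y and cancel; the term (XYf - YXf)σ is cancelled by
the ([X,Y]f)σ coming from ∇_{[X,Y]}(fσ). -/
theorem smoothTensorialAt_nablaCommutator (hX : SmoothNear I E X x) (hY : SmoothNear I E Y x) :
    SmoothTensorialAt I F (fun σ : Π x : M, V x => nablaCommutator cov X Y σ x) x where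
  smul {f σ} hf hσ := by
    simp only [nablaCommutator, Pi.sub_apply]
    rw [nabla_nabla_smul cov hf hσ hY, nabla_nabla_smul cov hf hσ hX,
      (eventually_nabla_smul cov hf hσ _).self_of_nhds]
    simp only [Pi.add_apply, Pi.smul_apply']
    rw [dirDeriv_mlieBracket hf hX hY]
    module
  add {σ τ} hσ hτ := by
    obtain ⟨U, hU, hUo, hx⟩ := mem_nhds_iff.1 ((hX.and hY).and (hσ.and hτ))
    exact nablaCommutator_add cov hUo hx (fun y hy => (hU hy).1.1.contMDiffWithinAt)
      (fun y hy => (hU hy).1.2.contMDiffWithinAt) (fun y hy => (hU hy).2.1.contMDiffWithinAt)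
      (fun y hy => (hU hy).2.2.contMDiffWithinAt)

/-- The term (Yf)∇_X σ from ∇_Y(f∇_X σ) cancels against the one from [fX, Y] = f[X, Y] - (Yf)X. -/
theorem smoothTensorialAt_nablaCommutator_left (hσ : SmoothNear I F σ x)
    (Y : Π x : M, TangentSpace I x) :
    SmoothTensorialAt I E (V := (TangentSpace I : M → Type _))
      (fun X : Π x : M, TangentSpace I x => nablaCommutator cov X Y σ x) x where
  smul {f X} hf hX := by
    have : CompleteSpace E := FiniteDimensional.complete ℝ E
    have : IsManifold I 2 M := .of_le (n := ∞) ENat.LEInfty.out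
    have e : nabla cov (f • X) σ = f • nabla cov X σ := by
      ext y; simp [nabla]
    simp only [nablaCommutator, Pi.sub_apply]
    rw [e, (eventually_nabla_smul cov hf (hX.nabla cov hσ) Y).self_of_nhds]
    simp only [nabla, dirDeriv, Pi.add_apply, Pi.smul_apply']
    rw [VectorField.mlieBracket_smul_left (mdiffAt_of_eventually_contMDiffAt hf) hX.mdiffAt]
    simp only [map_add, map_smul, neg_smul, map_neg]
    module
  add {X X'} hX hX' := by
    obtain ⟨U, hU, hx, h1, h2, h3⟩ := hX.exists_open₃ hX' hσ
    exact nablaCommutator_add_left cov hU hx h1 h2 h3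

/-- The arguments are exchanged one at a time; antisymmetry brings Y into the left slot. -/
theorem nablaCommutator_congr_value {X' Y' : Π x : M, TangentSpace I x}
    (hX : SmoothNear I E X x) (hX' : SmoothNear I E X' x) (hY : SmoothNear I E Y x)
    (hY' : SmoothNear I E Y' x) (hσ : SmoothNear I F σ x) (hτ : SmoothNear I F τ x)
    (eX : X x = X' x) (eY : Y x = Y' x) (e : σ x = τ x) :
    nablaCommutator cov X Y σ x = nablaCommutator cov X' Y' τ x := by
  rw [(smoothTensorialAt_nablaCommutator_left cov hσ Y).congr_value hX hX' eX,
    nablaCommutator_swap cov Y X',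
    (smoothTensorialAt_nablaCommutator_left cov hσ X').congr_value hY hY' eY,
    ← nablaCommutator_swap cov,
    (smoothTensorialAt_nablaCommutator cov hX' hY').congr_value hσ hτ e]

theorem curvature_apply (hX : SmoothNear I E X x) (hY : SmoothNear I E Y x)
    (hσ : SmoothNear I F σ x) :
    curvature cov x ![X x, Y x] (σ x) = nablaCommutator cov X Y σ x := by
  refine nablaCommutator_congr_value cov
    (smoothNear_localExt (V := (TangentSpace I : M → Type _)) _) hX
    (smoothNear_localExt (V := (TangentSpace I : M → Type _)) _) hY
    (smoothNear_localExt _) hσ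
    (localExt_self (V := (TangentSpace I : M → Type _)) _)
    (localExt_self (V := (TangentSpace I : M → Type _)) _) (localExt_self _)

end Nabla

/-! ### The exterior derivative of a 2-form, written out -/

theorem covExtDeriv_two (cov : CovariantDerivative I F V)
    (α : Π x : M, TangentSpace I x [⋀^Fin 2]→ₗ[ℝ] V x)
    (X : Fin 3 → Π x : M, TangentSpace I x) (x : M) :
    covExtDeriv cov α X x =
      nabla cov (X 0) (fun y => α y ![X 1 y, X 2 y]) x -
      nabla cov (X 1) (fun y => α y ![X 0 y, X 2 y]) x +
      nabla cov (X 2) (fun y => α y ![X 0 y, X 1 y]) x -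
      α x ![VectorField.mlieBracket I (X 0) (X 1) x, X 2 x] +
      α x ![VectorField.mlieBracket I (X 0) (X 2) x, X 1 x] -
      α x ![VectorField.mlieBracket I (X 1) (X 2) x, X 0 x] := by
  have e0 (y : M) : (Fin.removeNth 0 fun k => X k y) = ![X 1 y, X 2 y] := by
    ext i; fin_cases i <;> rfl
  have e1 (y : M) : (Fin.removeNth 1 fun k => X k y) = ![X 0 y, X 2 y] := by
    ext i; fin_cases i <;> rfl
  have e2 (y : M) : (Fin.removeNth 2 fun k => X k y) = ![X 0 y, X 1 y] := by
    ext i; fin_cases i <;> rfl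
  have r0 (v w z : TangentSpace I x) : Matrix.vecCons z (Fin.removeNth 0 ![v, w]) = ![z, w] := by
    ext i; fin_cases i <;> rfl
  have r1 (v w z : TangentSpace I x) : Matrix.vecCons z (Fin.removeNth 1 ![v, w]) = ![z, v] := by
    ext i; fin_cases i <;> rfl
  have f0 (f : Fin 2 → V x) : ∑ j ≥ 0, f j = f 0 + f 1 := by
    rw [show Finset.Ici (0 : Fin 2) = {0, 1} by decide, Finset.sum_pair zero_ne_one]
  have f1 (f : Fin 2 → V x) : ∑ j ≥ 1, f j = f 1 := by
    rw [show Finset.Ici (1 : Fin 2) = {1} by decide, Finset.sum_singleton]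
  -- The index pairs (i, j) = (0,0), (0,1), (1,1) stand for the brackets of fields (0,1), (0,2),
  -- (1,2), since the second field is `j.succ`.
  have h : covExtDeriv cov α X x =
      ((-1 : ℝ) ^ 0 • nabla cov (X 0) (fun y => α y (Fin.removeNth 0 fun k => X k y)) x +
        (-1 : ℝ) ^ 1 • nabla cov (X 1) (fun y => α y (Fin.removeNth 1 fun k => X k y)) x +
        (-1 : ℝ) ^ 2 • nabla cov (X 2) (fun y => α y (Fin.removeNth 2 fun k => X k y)) x) +
      (((-1 : ℝ) ^ (0 + (0 + 1)) • α x (Matrix.vecCons (VectorField.mlieBracket I (X 0) (X 1) x)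
          (Fin.removeNth 0 (Fin.removeNth 0 fun k => X k x))) +
        (-1 : ℝ) ^ (0 + (1 + 1)) • α x (Matrix.vecCons (VectorField.mlieBracket I (X 0) (X 2) x)
          (Fin.removeNth 1 (Fin.removeNth 0 fun k => X k x)))) +
        (-1 : ℝ) ^ (1 + (1 + 1)) • α x (Matrix.vecCons (VectorField.mlieBracket I (X 1) (X 2) x)
          (Fin.removeNth 1 (Fin.removeNth 1 fun k => X k x)))) :=
    congrArg₂ (· + ·) (Fin.sum_univ_three _)
      ((Fin.sum_univ_two _).trans (congrArg₂ (· + ·) (f0 _) (f1 _)))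
  rw [h]
  simp only [e0, e1, e2, r0, r1]
  module

/-! ### Differentiating the curvature as a section of End(V) -/

theorem endDiffAt_of_contMDiffAt_apply [FiniteDimensional ℝ F] [ContMDiffVectorBundle 1 F V I]
    {T : Π x : M, V x →L[ℝ] V x} {x : M}
    (h : ∀ u : V x, CMDiffAt 1 (T% (fun y => T y (localExt F u y))) x) :
    EndDiffAt (I := I) (F := F) T x := by
  refine ContMDiffAt.mdifferentiableAt (n := 1) ?_ one_ne_zero
  rw [contMDiffAt_hom_bundle]
  refine ⟨contMDiffAt_id, ?_⟩
  let e := trivializationAt F V x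
  have hx : x ∈ e.baseSet := mem_baseSet_trivializationAt F V x
  let b := Module.finBasis ℝ F
  -- `φ` lists the images of the basis vectors. The sections `localExt` of the frame vectors at `x`
  -- have constant coordinates, so the columns of T are the coordinates of T applied to them.
  let φ : (F →L[ℝ] F) ≃L[ℝ] (Fin (Module.finrank ℝ F) → F) :=
    (LinearMap.toContinuousLinearMap.symm.trans (b.constr ℝ).symm).toContinuousLinearEquiv
  let g : M → F →L[ℝ] F := fun y => ContinuousLinearMap.inCoordinates F V F V x y x y (T y)
  have hg : ContMDiffAt I 𝓘(ℝ, Fin (Module.finrank ℝ F) → F) 1 (fun y => φ (g y)) x := by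
    rw [contMDiffAt_pi_space]
    intro i
    have h1 := (e.contMDiffAt_section_iff hx).1 (h (e.symmL ℝ x (b i)))
    refine h1.congr_of_eventuallyEq ?_
    filter_upwards [e.open_baseSet.mem_nhds hx] with y hy
    have h2 : localExt F (e.symmL ℝ x (b i)) y = e.symmL ℝ y (b i) := by
      rw [localExt]
      congr 1
      exact e.continuousLinearMapAt_symmL hx (b i)
    have h3 : φ (g y) i = g y (b i) := by
      simp [φ, Module.Basis.constr]
    rw [h3, h2]
    exact e.continuousLinearMapAt_apply_of_mem (R := ℝ) hy _
  have h4 : CMDiffAt 1 (fun y => φ.symm (φ (g y))) x :=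
    φ.symm.contDiff.contMDiff.contMDiffAt.comp x hg
  simpa using h4

variable [FiniteDimensional ℝ E] [FiniteDimensional ℝ F] [IsManifold I ∞ M] [T2Space M]
  [ContMDiffVectorBundle ∞ F V I] [ContMDiffVectorBundle 1 F V I]
  (cov : CovariantDerivative I F V) [cov.ContMDiffCovariantDerivative ∞]
  {X Y Z : Π x : M, TangentSpace I x} {σ : Π x : M, V x} {x : M}

/-- The extensions that define `curvature` change with the base point, so regularity is not visible
from the definition. Near `x`, `curvature_apply` replaces them by fixed fields and a fixed section.
-/
theorem endDiffAt_curvature (hX : SmoothNear I E X x) (hY : SmoothNear I E Y x) :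
    EndDiffAt (I := I) (F := F) (fun y => curvature cov y ![X y, Y y]) x := by
  refine endDiffAt_of_contMDiffAt_apply fun u => ?_
  have hu := smoothNear_localExt (I := I) (F := F) u
  refine ((hX.nablaCommutator cov hY hu).congr ?_).self_of_nhds.of_le ENat.LEInfty.out
  filter_upwards [hX.eventually, hY.eventually, hu.eventually] with y h1 h2 h3
  exact curvature_apply cov h1 h2 h3

theorem nabla_endConnection_curvature (hX : SmoothNear I E X x) (hY : SmoothNear I E Y x)
    (hZ : SmoothNear I E Z x) (hσ : SmoothNear I F σ x) :
    nabla (endConnection cov) X (fun y => curvature cov y ![Y y, Z y]) x (σ x) =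
      nabla cov X (nablaCommutator cov Y Z σ) x - nablaCommutator cov Y Z (nabla cov X σ) x := by
  have h1 : nabla cov X (fun y => curvature cov y ![Y y, Z y] (σ y)) x =
      nabla cov X (nablaCommutator cov Y Z σ) x := by
    refine nabla_congr cov (hY.nablaCommutator cov hZ hσ).mdiffAt ?_ X
    filter_upwards [hY.eventually, hZ.eventually, hσ.eventually] with y h1 h2 h3
    exact curvature_apply cov h1 h2 h3
  have h2 := curvature_apply cov hY hZ (hX.nabla cov hσ)
  rw [← h1, ← h2]
  -- Differentiability excludes the default value 0 of `endNabla`.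
  exact endNabla_apply cov (endDiffAt_curvature cov hY hZ) (X x) hσ.mdiffAt

/-! ### Cancellation in the Bianchi identity -/

theorem nabla_nablaCommutator (hY : SmoothNear I E Y x) (hZ : SmoothNear I E Z x)
    (hσ : SmoothNear I F σ x) (X : Π x : M, TangentSpace I x) :
    nabla cov X (nablaCommutator cov Y Z σ) x =
      nabla cov X (nabla cov Y (nabla cov Z σ)) x - nabla cov X (nabla cov Z (nabla cov Y σ)) x -
        nabla cov X (nabla cov (VectorField.mlieBracket I Y Z) σ) x := by
  have h1 := hY.nabla cov (hZ.nabla cov hσ)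
  have h2 := hZ.nabla cov (hY.nabla cov hσ)
  rw [nablaCommutator, nabla_sub cov (h1.sub h2) ((hY.mlieBracket hZ).nabla cov hσ),
    nabla_sub cov h1 h2]

/-- The **second Bianchi identity**: the covariant exterior derivative of the curvature vanishes. -/
theorem covExtDeriv_curvature (X : Fin 3 → Π x : M, TangentSpace I x)
    (h : ∀ i, SmoothNear I E (X i) x) :
    covExtDeriv (endConnection cov) (curvature cov) X x = 0 := by
  ext u
  -- An arbitrary fibre vector becomes the value of a smooth section, on which the operator formulas
  -- apply.
  rw [← localExt_self (F := F) u]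
  have hσ := smoothNear_localExt (I := I) (F := F) u
  set σ := localExt F u
  have hb (i j) := (h i).mlieBracket (h j)
  rw [covExtDeriv_two]
  simp only [add_apply, sub_apply, zero_apply]
  rw [nabla_endConnection_curvature cov (h 0) (h 1) (h 2) hσ,
    nabla_endConnection_curvature cov (h 1) (h 0) (h 2) hσ,
    nabla_endConnection_curvature cov (h 2) (h 0) (h 1) hσ,
    curvature_apply cov (hb 0 1) (h 2) hσ, curvature_apply cov (hb 0 2) (h 1) hσ,
    curvature_apply cov (hb 1 2) (h 0) hσ,
    nabla_nablaCommutator cov (h 1) (h 2) hσ (X 0),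
    nabla_nablaCommutator cov (h 0) (h 2) hσ (X 1),
    nabla_nablaCommutator cov (h 0) (h 1) hσ (X 2)]
  have jac : nabla cov (VectorField.mlieBracket I (VectorField.mlieBracket I (X 0) (X 1)) (X 2)) σ x -
      nabla cov (VectorField.mlieBracket I (VectorField.mlieBracket I (X 0) (X 2)) (X 1)) σ x +
      nabla cov (VectorField.mlieBracket I (VectorField.mlieBracket I (X 1) (X 2)) (X 0)) σ x = 0 := by
    have h1 := mlieBracket_jacobi (h 0) (h 1) (h 2)
    rw [VectorField.mlieBracket_swap_apply (V := X 0),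
      VectorField.mlieBracket_swap_apply (V := X 1)] at h1
    simp only [nabla]
    rw [← map_sub, ← map_add]
    convert map_zero (cov σ x)
    rw [← sub_eq_zero.2 h1.symm]
    abel
  simp only [nablaCommutator, Pi.sub_apply]
  -- With 0 written as ∇ along the Jacobi sum, the rest is formal cancellation of iterated covariant
  -- derivatives.
  rw [← jac]
  abel

end

end BianchiIdentities

theorem mainTheorem2
    {E : Type*} [NormedAddCommGroup E] [NormedSpace ℝ E] [FiniteDimensional ℝ E]
    {H : Type*} [TopologicalSpace H] {I : ModelWithCorners ℝ E H} [I.Boundaryless]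
    {M : Type*} [TopologicalSpace M] [ChartedSpace H M] [IsManifold I ∞ M] [T2Space M]
    {F : Type*} [NormedAddCommGroup F] [NormedSpace ℝ F] [FiniteDimensional ℝ F]
    {V : M → Type*} [TopologicalSpace (TotalSpace F V)]
    [∀ x, AddCommGroup (V x)] [∀ x, Module ℝ (V x)] [∀ x, TopologicalSpace (V x)]
    [∀ x, IsTopologicalAddGroup (V x)] [∀ x, ContinuousSMul ℝ (V x)]
    [FiberBundle F V] [VectorBundle ℝ F V] [ContMDiffVectorBundle ∞ F V I]
    (γ : CovariantDerivative I F V) [γ.ContMDiffCovariantDerivative ∞]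
    (U : Set M) (hU : IsOpen U) (X : Fin 3 → Π x : M, TangentSpace I x)
    (hX : ∀ i, ContMDiffOn I (I.prod 𝓘(ℝ, E)) ∞
      (fun x => (⟨x, X i x⟩ : TangentBundle I M)) U) :
    ∀ x ∈ U, BianchiIdentities.covExtDeriv (BianchiIdentities.endConnection γ)
      (BianchiIdentities.curvature γ) X x = 0 := by
  intro x hx
  exact BianchiIdentities.covExtDeriv_curvature γ X fun i => .of_contMDiffOn hU hx (hX i)
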